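/- For $n\ge 0$ let $\mathfrak{D}_n$ be the set of derangements (fixed-point-free permutations) of $\{1,\dots,n\}$. For a permutation $\sigma$ of $\{1,\dots,n\}$ let $\mathrm{wex}(\sigma)$ be the number of $i$ with $\sigma(i)\ge i$, and let $\mathrm{cr}(\sigma)$ be the number of pairs $(i,j)$ such that either $i<j\le\sigma(i)<\sigma(j)$ or $\sigma(i)<\sigma(j)<i<j$. Let $[h]_q=1+q+\dots+q^{h-1}$, which is $\frac{1-q^h}{1-q}$ for $q\neq 1$, and define the $q$-secant numbers $E_{2k}(q)$ by the expansion, as a formal power series in $x$, \[ \sum_{k\ge 0}E_{2k}(q)\,x^k=\cfrac{1}{1-\cfrac{[1]_q^2\,x}{1-\cfrac{[2]_q^2\,x}{1-\cfrac{[3]_q^2\,x}{\ddots}}}} . \] Let $q$ be a nonzero element of a field (for instance the indeterminate $q$ in $\mathbb{Q}(q)$). Then for every $n\ge 0$ \[ \sum_{\sigma\in\mathfrak{D}_n}\left(-\tfrac1q\right)^{\mathrm{wex}(\sigma)}q^{\mathrm{cr}(\sigma)}= \begin{cases}\left(-\tfrac1q\right)^{n/2}E_n(q)&\text{if } n \text{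 is even},\\ 0&\text{if } n\text{ is odd.}\end{cases} \] -/

import Mathlib

open scoped PowerSeries

/-- Number of weak exceedances of `σ`: positions `i` with `i ≤ σ i`. -/
def wex {n : ℕ} (σ : Equiv.Perm (Fin n)) : ℕ :=
  (Finset.univ.filter fun i : Fin n => i ≤ σ i).card

/-- Number of crossings of `σ`: pairs `(i, j)` such that
`i < j ≤ σ i < σ j` or `σ i < σ j < i < j`. -/
def cr {n : ℕ} (σ : Equiv.Perm (Fin n)) : ℕ :=
  (Finset.univ.filter fun p : Fin n × Fin n =>
    (p.1 < p.2 ∧ p.2 ≤ σ p.1 ∧ σ p.1 < σ p.2) ∨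
    (σ p.1 < σ p.2 ∧ σ p.2 < p.1 ∧ p.1 < p.2)).card

/-- The `q`-integer `[h]_q = 1 + q + ⋯ + q ^ (h - 1)`, equal to `(1 - q ^ h) / (1 - q)`
when `q ≠ 1`. -/
def qInt {K : Type*} [Field K] (q : K) (h : ℕ) : K :=
  ∑ i ∈ Finset.range h, q ^ i

theorem qInt_eq_div {K : Type*} [Field K] (q : K) (hq : q ≠ 1) (h : ℕ) :
    qInt q h = (1 - q ^ h) / (1 - q) := by
  rw [eq_div_iff (sub_ne_zero.mpr hq.symm)]
  exact geom_sum_mul_neg q h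

/-- The finite truncation, with `m` levels, of the tail starting at index `h` of the
continued fraction `1 / (1 - c 0 x / (1 - c 1 x / (1 - c 2 x / ⋯)))`, namely
`1 / (1 - c h x / (1 - ⋯ / (1 - c (h + m - 1) x)))`, as a formal power series in `x`. -/
noncomputable def contFracTrunc {K : Type*} [Field K] (c : ℕ → K) : ℕ → ℕ → K⟦X⟧
  | 0, _ => 1
  | m + 1, h =>
      (1 - PowerSeries.C (c h) * PowerSeries.X * contFracTrunc c m (h + 1))⁻¹

/-- The formal power series given by the infinite continued fraction
`1 / (1 - c 0 x / (1 - c 1 x / (1 - c 2 x / ⋯)))`, the coefficientwise limit of its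
truncations: the coefficient of `x ^ n` is the same in all truncations with at least `n` levels
(see `coeff_contFracTrunc_eq`). -/
noncomputable def contFrac {K : Type*} [Field K] (c : ℕ → K) : K⟦X⟧ :=
  PowerSeries.mk fun n => PowerSeries.coeff n (contFracTrunc c n 0)

theorem X_pow_dvd_contFracTrunc_sub {K : Type*} [Field K] (c : ℕ → K) (n : ℕ) :
    ∀ (m h : ℕ), n ≤ m →
      (PowerSeries.X : K⟦X⟧) ^ (n + 1) ∣ contFracTrunc c m h - contFracTrunc c n h := by
  have key : ∀ (m h : ℕ), (1 - PowerSeries.C (c h) * PowerSeries.X * contFracTrunc c m (h + 1)) *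
      (1 - PowerSeries.C (c h) * PowerSeries.X * contFracTrunc c m (h + 1))⁻¹ = 1 := by
    intro m h
    apply PowerSeries.mul_inv_cancel
    simp
  induction n with
  | zero =>
    intro m h _
    cases m with
    | zero => simp
    | succ m =>
      have h1 := key m h
      simp only [contFracTrunc]
      set b := (1 - PowerSeries.C (c h) * PowerSeries.X * contFracTrunc c m (h + 1))⁻¹
      exact ⟨PowerSeries.C (c h) * contFracTrunc c m (h + 1) * b, by linear_combination h1⟩
  | succ n ih =>
    intro m h hm
    cases m with
    | zero => omega
    | succ m =>
      obtain ⟨d, hd⟩ := ih m (h + 1) (by omega)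
      have h1 := key m h
      have h2 := key n h
      simp only [contFracTrunc]
      set s := contFracTrunc c m (h + 1)
      set t := contFracTrunc c n (h + 1)
      set a := (1 - PowerSeries.C (c h) * PowerSeries.X * s)⁻¹
      set b := (1 - PowerSeries.C (c h) * PowerSeries.X * t)⁻¹
      refine ⟨PowerSeries.C (c h) * d * a * b, ?_⟩
      linear_combination b * h1 - a * h2 + PowerSeries.C (c h) * PowerSeries.X * a * b * hd

theorem coeff_contFracTrunc_eq {K : Type*} [Field K] (c : ℕ → K) (n m : ℕ) (h : n ≤ m) :
    PowerSeries.coeff n (contFracTrunc c m 0) = PowerSeries.coeff n (contFrac c) := by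
  have := (PowerSeries.X_pow_dvd_iff.mp (X_pow_dvd_contFracTrunc_sub c n m 0 h)) n (by omega)
  rw [map_sub, sub_eq_zero] at this
  rw [this, contFrac, PowerSeries.coeff_mk]

/-- The `q`-secant number `E_{2k}(q)`: the coefficient of `x ^ k` in
`1 / (1 - [1]_q ^ 2 x / (1 - [2]_q ^ 2 x / (1 - [3]_q ^ 2 x / ⋯)))`. -/
noncomputable def qSecant {K : Type*} [Field K] (q : K) (k : ℕ) : K :=
  PowerSeries.coeff k (contFrac fun h => qInt q (h + 1) ^ 2)

/-!
A derangement of a linearly ordered set is a placement of non-attacking rooks off the diagonal, and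
is built by adding the row and the column of each element in increasing order. The state of the
construction is the number `h` of rows without a rook, which is also the number of columns without a
rook. If the rook of a new column goes into one of the `h` free rows, the free rows after the chosen
one each account for one crossing that is now decided, so the `h` choices contribute `[h]_q`, and
the same holds for a new row. Each new element is therefore a step of a Motzkin path: up with weight
`1`, level with weight `(1 + y q) [h]_q`, down with weight `y [h]_q ^ 2`, where `y` marks the weak
exceedances. The extra `q` in the level weight is the crossing of the new column with its own row,
still free. For `y = -1 / q` the level steps cancel, and the generating function of the remaining
Dyck paths is Stieltjes' continued fraction.
-/

section MotzkinPaths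

variable {R : Type*} [CommSemiring R]

/-- The transfer operator of weighted Motzkin paths: an up step has weight `1`, a level step at
height `h` has weight `b h`, and a down step from height `h + 1` has weight `c h`. Thus
`(motzkinStep b c)^[n] (Pi.single 0 1) h` is the total weight of the paths with `n` steps from
height `h` to height `0`. -/
def motzkinStep (b c g : ℕ → R) : ℕ → R
  | 0 => g 1 + b 0 * g 0
  | h + 1 => g (h + 2) + b (h + 1) * g (h + 1) + c h * g h

end MotzkinPaths

section ContinuedFractions

open PowerSeries

variable {K : Type*} [Field K]

theorem contFracTrunc_succ_mul (c : ℕ → K) (m h : ℕ) :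
    contFracTrunc c (m + 1) h * (1 - C (c h) * X * contFracTrunc c m (h + 1)) = 1 := by
  rw [contFracTrunc]
  exact PowerSeries.inv_mul_cancel _ (by simp)

theorem contFracTrunc_comp_succ (c : ℕ → K) (m h : ℕ) :
    contFracTrunc (fun i => c (i + 1)) m h = contFracTrunc c m (h + 1) := by
  induction m generalizing h with
  | zero => rfl
  | succ m ih => rw [contFracTrunc, contFracTrunc, ih]

theorem X_pow_dvd_contFrac_sub_contFracTrunc (c : ℕ → K) {n m : ℕ} (hnm : n ≤ m) :
    (X : K⟦X⟧) ^ (n + 1) ∣ contFrac c - contFracTrunc c m 0 := by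
  refine X_pow_dvd_iff.mpr fun k hk => ?_
  rw [map_sub, coeff_contFracTrunc_eq c k m (by omega), sub_self]

theorem contFrac_eq_one_add (c : ℕ → K) :
    contFrac c = 1 + C (c 0) * X * (contFrac c * contFrac fun i => c (i + 1)) := by
  set F := contFrac c
  set G := contFrac fun i => c (i + 1)
  have h_dvd (n : ℕ) : X ^ (n + 1) ∣ F - (1 + C (c 0) * X * (F * G)) := by
    set T := contFracTrunc c (n + 1) 0
    set S := contFracTrunc (fun i => c (i + 1)) n 0 with hS
    have hF : X ^ (n + 1) ∣ F - T := X_pow_dvd_contFrac_sub_contFracTrunc c n.le_succ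
    have hG : X ^ (n + 1) ∣ G - S := X_pow_dvd_contFrac_sub_contFracTrunc _ le_rfl
    have hTS : T * (1 - C (c 0) * X * S) = 1 := by
      rw [hS, contFracTrunc_comp_succ]
      exact contFracTrunc_succ_mul c n 0
    have h_split : F - (1 + C (c 0) * X * (F * G)) =
        (F - T) * (1 - C (c 0) * X * G) - C (c 0) * X * T * (G - S) := by
      linear_combination hTS
    rw [h_split]
    exact dvd_sub (hF.mul_right _) (hG.mul_left _)
  rw [← sub_eq_zero]
  ext n
  exact X_pow_dvd_iff.mp (h_dvd n) n n.lt_succ_self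

theorem rescale_C {R : Type*} [CommSemiring R] (a r : R) : rescale a (C r) = C r := by
  ext n
  rcases n with _ | n <;> simp [coeff_rescale, coeff_C]

theorem contFracTrunc_const_mul (a : K) (c : ℕ → K) (m h : ℕ) :
    contFracTrunc (fun i => a * c i) m h = rescale a (contFracTrunc c m h) := by
  induction m generalizing h with
  | zero => simp [contFracTrunc]
  | succ m ih =>
    have h_rescaled := congrArg (rescale a) (contFracTrunc_succ_mul c m h)
    simp only [map_mul, map_sub, map_one, rescale_X, rescale_C] at h_rescaled
    rw [contFracTrunc, PowerSeries.inv_eq_iff_mul_eq_one (by simp), ih, map_mul C]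
    linear_combination h_rescaled

theorem contFrac_const_mul (a : K) (c : ℕ → K) :
    contFrac (fun i => a * c i) = rescale a (contFrac c) := by
  ext n
  simp only [contFrac, coeff_mk, coeff_rescale, contFracTrunc_const_mul]

/-- The generating function, by number of steps, of the weighted Dyck paths from height `h` to
height `0`. The first visit to each height cuts such a path into `h` down steps and `h + 1`
excursions, and the excursions from height `i` back to it are counted by the `i`-th tail of the
continued fraction, with its variable squared because every up step is undone. -/
noncomputable def dyckSeries (c : ℕ → K) : ℕ → K⟦X⟧
  | 0 => expand 2 two_ne_zero (contFrac c)
  | h + 1 => C (c h) * X * dyckSeries c h *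
      expand 2 two_ne_zero (contFrac fun i => c (i + (h + 1)))

theorem expand_contFrac_eq_one_add (c : ℕ → K) (h : ℕ) :
    expand 2 two_ne_zero (contFrac fun i => c (i + h)) =
      1 + C (c h) * X ^ 2 * (expand 2 two_ne_zero (contFrac fun i => c (i + h)) *
        expand 2 two_ne_zero (contFrac fun i => c (i + (h + 1)))) := by
  conv_lhs => rw [contFrac_eq_one_add]
  simp only [map_add, map_mul, map_one, expand_C, expand_X, zero_add, add_assoc, add_comm 1]

theorem dyckSeries_zero (c : ℕ → K) : dyckSeries c 0 = 1 + X * dyckSeries c 1 := by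
  simp only [dyckSeries]
  linear_combination expand_contFrac_eq_one_add c 0

theorem dyckSeries_succ (c : ℕ → K) (h : ℕ) :
    dyckSeries c (h + 1) = X * dyckSeries c (h + 2) + C (c h) * X * dyckSeries c h := by
  simp only [dyckSeries]
  linear_combination C (c h) * X * dyckSeries c h * expand_contFrac_eq_one_add c (h + 1)

theorem motzkinStep_zero_iterate_eq_coeff_dyckSeries (c : ℕ → K) (n h : ℕ) :
    (motzkinStep 0 c)^[n] (Pi.single 0 1) h = coeff n (dyckSeries c h) := by
  induction n generalizing h with
  | zero =>
    cases h with
    | zero => simp [dyckSeries_zero]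
    | succ h => simp [dyckSeries]
  | succ n ih =>
    rw [Function.iterate_succ_apply']
    cases h with
    | zero => simp [motzkinStep, ih, dyckSeries_zero, coeff_succ_X_mul, coeff_one]
    | succ h => simp [motzkinStep, ih, dyckSeries_succ c h, mul_assoc, coeff_succ_X_mul]

theorem motzkinStep_zero_iterate_apply_zero (c : ℕ → K) (n : ℕ) :
    (motzkinStep 0 c)^[n] (Pi.single 0 1) 0 =
      if Even n then coeff (n / 2) (contFrac c) else 0 := by
  rw [motzkinStep_zero_iterate_eq_coeff_dyckSeries, dyckSeries]
  split_ifs with hn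
  · obtain ⟨k, rfl⟩ := even_iff_two_dvd.mp hn
    rw [coeff_expand_mul, Nat.mul_div_cancel_left k two_pos]
  · exact coeff_expand_of_not_dvd _ _ _ fun h => hn (even_iff_two_dvd.mpr h)

end ContinuedFractions

section RookPlacements

open Finset

theorem sum_filter_powerset_union {ι M : Type*} [DecidableEq ι] [AddCommMonoid M]
    {P : Finset ι → Prop} [DecidablePred P] (hP : ∀ p p', p ⊆ p' → P p' → P p)
    {B L : Finset ι} (hBL : Disjoint B L)
    (hL : ∀ p, P p → ∀ x ∈ L, ∀ z ∈ L, x ∈ p → z ∈ p → x = z) (f : Finset ι → M) :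
    ∑ p ∈ (B ∪ L).powerset with P p, f p =
      ∑ p ∈ B.powerset with P p, (f p + ∑ x ∈ L with P (insert x p), f (insert x p)) := by
  induction L using Finset.induction_on with
  | empty => simp
  | insert x L hx ih =>
    rw [disjoint_insert_right] at hBL
    have h_new : ∑ p ∈ (B ∪ L).powerset, (if P (insert x p) then f (insert x p) else 0) =
        ∑ p ∈ B.powerset, if P (insert x p) then f (insert x p) else 0 := by
      refine (sum_subset (powerset_mono.mpr subset_union_left) fun p hp hpB => if_neg ?_).symm
      intro h_ins
      obtain ⟨z, hzp, hzB⟩ := not_subset.mp (mem_powerset.not.mp hpB)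
      have hzL : z ∈ L := (mem_union.mp (mem_powerset.mp hp hzp)).resolve_left hzB
      have hxz : x = z := hL _ h_ins x (mem_insert_self x L) z (mem_insert_of_mem hzL)
        (mem_insert_self x p) (mem_insert_of_mem hzp)
      exact hx (hxz ▸ hzL)
    have h_old := ih hBL.2 fun p hp y hy z hz =>
      hL p hp y (mem_insert_of_mem hy) z (mem_insert_of_mem hz)
    rw [sum_filter] at h_old
    rw [union_insert, sum_filter, sum_powerset_insert (by simp [hx, hBL.1]), h_new, h_old,
      sum_filter, sum_filter, ← sum_add_distrib]
    refine sum_congr rfl fun p _ => ?_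
    by_cases hp : P p
    · simp only [if_pos hp, sum_filter, sum_insert hx]
      abel
    · rw [if_neg hp, if_neg hp, zero_add, if_neg fun h => hp (hP _ _ (subset_insert x p) h)]

variable {α β M : Type*}

/-- A set of cells `(i, v)` of a board with rows `α` and columns `β` is non-attacking when no two
of its cells share a row or a column, i.e. when it is the graph of a partial injection. -/
def IsNonattacking (p : Finset (α × β)) : Prop :=
  Set.InjOn Prod.fst (p : Set (α × β)) ∧ Set.InjOn Prod.snd (p : Set (α × β))

theorem IsNonattacking.mono {p p' : Finset (α × β)} (h : p ⊆ p') (hp' : IsNonattacking p') :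
    IsNonattacking p :=
  ⟨hp'.1.mono (coe_subset.mpr h), hp'.2.mono (coe_subset.mpr h)⟩

theorem IsNonattacking.card_le_of_subset_product {s : Finset α} {t : Finset β}
    {p : Finset (α × β)} (hp : IsNonattacking p) (hps : p ⊆ s ×ˢ t) : #p ≤ #s :=
  card_le_card_of_injOn Prod.fst (fun _ hz => (mem_product.mp (hps hz)).1) hp.1

open Classical in
/-- The placements of non-attacking rooks on the cells of the board `B`. -/
noncomputable def rookPlacements (B : Finset (α × β)) : Finset (Finset (α × β)) :=
  {p ∈ B.powerset | IsNonattacking p}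

theorem mem_rookPlacements {B p : Finset (α × β)} :
    p ∈ rookPlacements B ↔ p ⊆ B ∧ IsNonattacking p := by
  simp [rookPlacements]

/-- The rows in `s` that contain no rook of the placement `p`. -/
def freeRows [DecidableEq α] (s : Finset α) (p : Finset (α × β)) : Finset α :=
  s \ p.image Prod.fst

/-- The columns in `t` that contain no rook of the placement `p`. -/
def freeCols [DecidableEq β] (t : Finset β) (p : Finset (α × β)) : Finset β :=
  t \ p.image Prod.snd

theorem mem_freeRows [DecidableEq α] {s : Finset α} {p : Finset (α × β)} {i : α} :
    i ∈ freeRows s p ↔ i ∈ s ∧ ∀ z ∈ p, z.1 ≠ i := by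
  simp only [freeRows, mem_sdiff, mem_image, not_exists, not_and, ne_eq]

theorem mem_freeCols [DecidableEq β] {t : Finset β} {p : Finset (α × β)} {v : β} :
    v ∈ freeCols t p ↔ v ∈ t ∧ ∀ z ∈ p, z.2 ≠ v := by
  simp only [freeCols, mem_sdiff, mem_image, not_exists, not_and, ne_eq]

theorem card_freeRows [DecidableEq α] {s : Finset α} {p : Finset (α × β)}
    (hps : ∀ z ∈ p, z.1 ∈ s) (hp : IsNonattacking p) : #(freeRows s p) = #s - #p := by
  rw [freeRows, card_sdiff_of_subset (image_subset_iff.mpr hps), card_image_of_injOn hp.1]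

theorem card_freeCols [DecidableEq β] {t : Finset β} {p : Finset (α × β)}
    (hpt : ∀ z ∈ p, z.2 ∈ t) (hp : IsNonattacking p) : #(freeCols t p) = #t - #p := by
  rw [freeCols, card_sdiff_of_subset (image_subset_iff.mpr hpt), card_image_of_injOn hp.2]

variable [DecidableEq α] [DecidableEq β]

theorem freeRows_insert_of_notMem {s : Finset α} {a : α} (ha : a ∉ s) (v : β)
    (p : Finset (α × β)) : freeRows s (insert (a, v) p) = freeRows s p := by
  rw [freeRows, image_insert, sdiff_insert_of_notMem ha, freeRows]

theorem isNonattacking_insert {x : α × β} {p : Finset (α × β)} (hx : x ∉ p) :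
    IsNonattacking (insert x p) ↔ IsNonattacking p ∧ ∀ z ∈ p, z.1 ≠ x.1 ∧ z.2 ≠ x.2 := by
  rw [IsNonattacking, coe_insert, Set.injOn_insert hx, Set.injOn_insert hx, IsNonattacking]
  simp only [Set.mem_image, mem_coe, not_exists, not_and]
  grind

variable [AddCommMonoid M]

theorem sum_rookPlacements_union_row {B : Finset (α × β)} {a : α} (ha : ∀ x ∈ B, x.1 ≠ a)
    (t : Finset β) (f : Finset (α × β) → M) :
    ∑ p ∈ rookPlacements (B ∪ {a} ×ˢ t), f p =
      ∑ p ∈ rookPlacements B, (f p + ∑ v ∈ freeCols t p, f (insert (a, v) p)) := by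
  classical
  rw [rookPlacements, sum_filter_powerset_union (fun _ _ => IsNonattacking.mono)]
  · refine sum_congr rfl fun p hp => congrArg (f p + ·) ?_
    obtain ⟨hpB, hp⟩ := mem_rookPlacements.mp hp
    rw [sum_filter, sum_product, sum_singleton, freeCols, sdiff_eq_filter, sum_filter]
    refine sum_congr rfl fun v _ => if_congr ?_ rfl rfl
    rw [isNonattacking_insert fun h => ha _ (hpB h) rfl]
    simp only [mem_image, not_exists, not_and]
    exact ⟨fun h z hz => (h.2 z hz).2, fun h => ⟨hp, fun z hz => ⟨ha z (hpB hz), h z hz⟩⟩⟩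
  · refine disjoint_left.mpr fun x hxB hx => ha x hxB ?_
    exact mem_singleton.mp (mem_product.mp hx).1
  · intro p hp x hx z hz hxp hzp
    refine hp.1 hxp hzp ?_
    rw [mem_singleton.mp (mem_product.mp hx).1, mem_singleton.mp (mem_product.mp hz).1]

theorem sum_rookPlacements_union_col {B : Finset (α × β)} {b : β} (hb : ∀ x ∈ B, x.2 ≠ b)
    (s : Finset α) (f : Finset (α × β) → M) :
    ∑ p ∈ rookPlacements (B ∪ s ×ˢ {b}), f p =
      ∑ p ∈ rookPlacements B, (f p + ∑ i ∈ freeRows s p, f (insert (i, b) p)) := by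
  classical
  rw [rookPlacements, sum_filter_powerset_union (fun _ _ => IsNonattacking.mono)]
  · refine sum_congr rfl fun p hp => congrArg (f p + ·) ?_
    obtain ⟨hpB, hp⟩ := mem_rookPlacements.mp hp
    rw [sum_filter, sum_product_right, sum_singleton, freeRows, sdiff_eq_filter, sum_filter]
    refine sum_congr rfl fun i _ => if_congr ?_ rfl rfl
    rw [isNonattacking_insert fun h => hb _ (hpB h) rfl]
    simp only [mem_image, not_exists, not_and]
    exact ⟨fun h z hz => (h.2 z hz).1, fun h => ⟨hp, fun z hz => ⟨h z hz, hb z (hpB hz)⟩⟩⟩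
  · refine disjoint_left.mpr fun x hxB hx => hb x hxB ?_
    exact mem_singleton.mp (mem_product.mp hx).2
  · intro p hp x hx z hz hxp hzp
    refine hp.2 hxp hzp ?_
    rw [mem_singleton.mp (mem_product.mp hx).2, mem_singleton.mp (mem_product.mp hz).2]

theorem sum_rookPlacements_offDiag_insert {s : Finset α} {a : α} (ha : a ∉ s)
    (f : Finset (α × α) → M) :
    ∑ p ∈ rookPlacements (insert a s).offDiag, f p =
      ∑ p ∈ rookPlacements s.offDiag,
        (f p + ∑ i ∈ freeRows s p, f (insert (i, a) p) +
          ∑ v ∈ freeCols s p, (f (insert (a, v) p) +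
            ∑ i ∈ freeRows s p, f (insert (i, a) (insert (a, v) p)))) := by
  have h_row : ∀ x ∈ s.offDiag, x.1 ≠ a := fun x hx =>
    ne_of_mem_of_not_mem (mem_offDiag.mp hx).1 ha
  have h_col : ∀ x ∈ s.offDiag ∪ {a} ×ˢ s, x.2 ≠ a := by
    intro x hx
    rcases mem_union.mp hx with hx | hx
    · exact ne_of_mem_of_not_mem (mem_offDiag.mp hx).2.1 ha
    · exact ne_of_mem_of_not_mem (mem_product.mp hx).2 ha
  rw [offDiag_insert ha, sum_rookPlacements_union_col h_col, sum_rookPlacements_union_row h_row]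
  simp only [freeRows_insert_of_notMem ha]

end RookPlacements

section PlacementWeights

open Finset

theorem card_insert_sub_card_insert {α β : Type*} [DecidableEq α] [DecidableEq β] {s : Finset α}
    {a : α} (ha : a ∉ s) {t : Finset β} {b : β} (hb : b ∉ t) :
    #(insert a s) - #(insert b t) = #s - #t := by
  rw [card_insert_of_notMem ha, card_insert_of_notMem hb, Nat.add_sub_add_right]

theorem sum_pow_card_filter_lt {α R : Type*} [LinearOrder α] [Semiring R] (q : R)
    (s : Finset α) :
    ∑ v ∈ s, q ^ #{w ∈ s | v < w} = ∑ i ∈ range #s, q ^ i := by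
  induction s using Finset.induction_on_min with
  | empty => simp
  | insert a s ha ih =>
    have has : a ∉ s := fun h => lt_irrefl a (ha a h)
    have h_min : {w ∈ insert a s | a < w} = s := by
      rw [filter_insert, if_neg (lt_irrefl a), filter_true_of_mem ha]
    have h_old : ∀ v ∈ s, {w ∈ insert a s | v < w} = {w ∈ s | v < w} := fun v hv => by
      rw [filter_insert, if_neg (ha v hv).not_gt]
    rw [sum_insert has, card_insert_of_notMem has, sum_range_succ, ← ih, h_min, add_comm,
      sum_congr rfl fun v hv => by rw [h_old v hv]]

variable {α R : Type*} [LinearOrder α] [CommSemiring R]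

/-- The number of crossings in which the rook `x` of the placement `p`, seen as an arc from `x.1`
to `x.2`, is the arc completed first, when the lines of the board are added in increasing order.
A line of `s` that is still free at that moment counts, as its rook is then placed later. -/
def rookCrossings (s : Finset α) (p : Finset (α × α)) (x : α × α) : ℕ :=
  if x.1 < x.2 then #{j ∈ s | (x.1 < j ∧ j ≤ x.2) ∧ ∀ z ∈ p, z.1 = j → x.2 < z.2}
  else #{w ∈ s | (x.2 < w ∧ w < x.1) ∧ ∀ z ∈ p, z.2 = w → x.1 < z.1}

/-- The weight of a placement of rooks on `s.offDiag`: `y` marks the rooks above the diagonal and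
`q` marks the crossings. -/
def placementWeight (y q : R) (s : Finset α) (p : Finset (α × α)) : R :=
  y ^ #{x ∈ p | x.1 < x.2} * q ^ ∑ x ∈ p, rookCrossings s p x

theorem rookCrossings_insert_line {a : α} {x : α × α} (h₁ : x.1 ≤ a) (h₂ : x.2 < a)
    (s : Finset α) (p : Finset (α × α)) :
    rookCrossings (insert a s) p x = rookCrossings s p x := by
  simp only [rookCrossings, filter_insert, h₁.not_gt, h₂.not_ge, and_false, false_and, if_false]

theorem rookCrossings_insert_of_lt_fst {x z : α × α} (h₁ : x.1 < z.1) (h₂ : x.2 < z.1)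
    (s : Finset α) (p : Finset (α × α)) :
    rookCrossings s (insert z p) x = rookCrossings s p x := by
  rw [rookCrossings, rookCrossings]
  congr 2 <;> exact filter_congr fun j _ => by simp only [forall_mem_insert]; grind

theorem rookCrossings_insert_of_lt_snd {x z : α × α} (h₁ : x.1 ≤ z.2) (h₂ : x.2 < z.2)
    (s : Finset α) (p : Finset (α × α)) :
    rookCrossings s (insert z p) x = rookCrossings s p x := by
  rw [rookCrossings, rookCrossings]
  congr 2 <;> exact filter_congr fun j _ => by simp only [forall_mem_insert]; grind

theorem placementWeight_insert_of_lt {z : α × α} (h : z.1 < z.2) {s : Finset α}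
    {p : Finset (α × α)} (hp : ∀ x ∈ p, x.1 ≤ z.2 ∧ x.2 < z.2) (y q : R) :
    placementWeight y q s (insert z p) =
      y * q ^ rookCrossings s (insert z p) z * placementWeight y q s p := by
  have hz : z ∉ p := fun hz => lt_irrefl _ (hp z hz).2
  rw [placementWeight, filter_insert, if_pos h, card_insert_of_notMem (by simp [hz]),
    sum_insert hz, sum_congr rfl fun x hx =>
      rookCrossings_insert_of_lt_snd (hp x hx).1 (hp x hx).2 s p, placementWeight]
  ring

theorem placementWeight_insert_of_gt {z : α × α} (h : z.2 < z.1) {s : Finset α}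
    {p : Finset (α × α)} (hp : ∀ x ∈ p, x.1 < z.1 ∧ x.2 < z.1) (y q : R) :
    placementWeight y q s (insert z p) =
      q ^ rookCrossings s (insert z p) z * placementWeight y q s p := by
  have hz : z ∉ p := fun hz => lt_irrefl _ (hp z hz).1
  rw [placementWeight, filter_insert, if_neg h.not_gt, sum_insert hz, sum_congr rfl fun x hx =>
      rookCrossings_insert_of_lt_fst (hp x hx).1 (hp x hx).2 s p, placementWeight]
  ring

section MaximalLine

variable {s : Finset α} {a : α} {p : Finset (α × α)}

theorem rookCrossings_insert_max_col {T : Finset α} (hT : ∀ j ∈ T, j ≤ a)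
    (hp : ∀ x ∈ p, x.2 < a) {i : α} (hi : i < a) :
    rookCrossings T (insert (i, a) p) (i, a) = #{j ∈ freeRows T p | i < j} := by
  rw [rookCrossings, if_pos hi]
  congr 1
  ext j
  simp only [mem_filter, mem_freeRows, forall_mem_insert]
  grind

theorem rookCrossings_insert_max_row (ha : ∀ j ∈ s, j < a) (hp : ∀ x ∈ p, x.1 < a) {v : α}
    (hv : v < a) :
    rookCrossings (insert a s) (insert (a, v) p) (a, v) = #{w ∈ freeCols s p | v < w} := by
  rw [rookCrossings, if_neg hv.not_gt]
  congr 1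
  ext w
  simp only [mem_filter, mem_insert, mem_freeCols]
  grind

variable (ha : ∀ j ∈ s, j < a) (hp : p ⊆ s ×ˢ s)
include ha hp

theorem lt_and_lt_of_mem {x : α × α} (hx : x ∈ p) : x.1 < a ∧ x.2 < a :=
  ⟨ha _ (mem_product.mp (hp hx)).1, ha _ (mem_product.mp (hp hx)).2⟩

variable (y q : R)

theorem placementWeight_insert_line :
    placementWeight y q (insert a s) p = placementWeight y q s p := by
  rw [placementWeight, placementWeight, sum_congr rfl fun x hx =>
    rookCrossings_insert_line (lt_and_lt_of_mem ha hp hx).1.le (lt_and_lt_of_mem ha hp hx).2 s p]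

theorem sum_placementWeight_insert_row :
    ∑ v ∈ freeCols s p, placementWeight y q (insert a s) (insert (a, v) p) =
      (∑ i ∈ range #(freeCols s p), q ^ i) * placementWeight y q s p := by
  rw [← sum_pow_card_filter_lt, sum_mul]
  refine sum_congr rfl fun v hv => ?_
  have hva : v < a := ha v (mem_freeCols.mp hv).1
  have hpa : ∀ x ∈ p, x.1 < a ∧ x.2 < a := fun _ => lt_and_lt_of_mem ha hp
  rw [placementWeight_insert_of_gt hva hpa,
    rookCrossings_insert_max_row ha (fun x hx => (hpa x hx).1) hva,
    placementWeight_insert_line ha hp]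

theorem sum_placementWeight_insert_col :
    ∑ i ∈ freeRows s p, placementWeight y q (insert a s) (insert (i, a) p) =
      y * q * (∑ i ∈ range #(freeRows s p), q ^ i) * placementWeight y q s p := by
  have hpa : ∀ x ∈ p, x.1 < a ∧ x.2 < a := fun _ => lt_and_lt_of_mem ha hp
  have h_free : freeRows (insert a s) p = insert a (freeRows s p) := by
    ext i
    simp only [mem_freeRows, mem_insert]
    grind
  rw [← sum_pow_card_filter_lt, mul_sum, sum_mul]
  refine sum_congr rfl fun i hi => ?_
  have hia : i < a := ha i (mem_freeRows.mp hi).1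
  have haF : a ∉ freeRows s p := fun h => lt_irrefl a (ha a (mem_freeRows.mp h).1)
  rw [placementWeight_insert_of_lt hia fun x hx => ⟨(hpa x hx).1.le, (hpa x hx).2⟩,
    rookCrossings_insert_max_col (forall_mem_insert .. |>.mpr ⟨le_rfl, fun j hj => (ha j hj).le⟩)
      (fun x hx => (hpa x hx).2) hia,
    h_free, filter_insert, if_pos hia, card_insert_of_notMem (by simp [haF]),
    placementWeight_insert_line ha hp]
  ring

theorem sum_placementWeight_insert_row_col :
    ∑ v ∈ freeCols s p, ∑ i ∈ freeRows s p,
        placementWeight y q (insert a s) (insert (i, a) (insert (a, v) p)) =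
      y * (∑ i ∈ range #(freeRows s p), q ^ i) * (∑ i ∈ range #(freeCols s p), q ^ i) *
        placementWeight y q s p := by
  rw [mul_assoc, ← sum_placementWeight_insert_row ha hp, mul_sum]
  refine sum_congr rfl fun v hv => ?_
  have hpa : ∀ x ∈ insert (a, v) p, x.1 ≤ a ∧ x.2 < a :=
    forall_mem_insert .. |>.mpr ⟨⟨le_rfl, ha v (mem_freeCols.mp hv).1⟩, fun _ hx =>
      (lt_and_lt_of_mem ha hp hx).imp_left le_of_lt⟩
  have h_free : freeRows (insert a s) (insert (a, v) p) = freeRows s p := by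
    ext i
    simp only [mem_freeRows, mem_insert]
    grind
  rw [← sum_pow_card_filter_lt, mul_sum, sum_mul]
  refine sum_congr rfl fun i hi => ?_
  have hia : i < a := ha i (mem_freeRows.mp hi).1
  rw [placementWeight_insert_of_lt hia hpa,
    rookCrossings_insert_max_col (forall_mem_insert .. |>.mpr ⟨le_rfl, fun j hj => (ha j hj).le⟩)
      (fun x hx => (hpa x hx).2) hia, h_free]

end MaximalLine

/-- The transfer operator of the weighted derangements: a height is the number of free rows, which
is also the number of free columns. -/
def derangementStep (y q : R) : (ℕ → R) → ℕ → R :=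
  motzkinStep (fun h => (1 + y * q) * ∑ i ∈ range h, q ^ i)
    (fun h => y * (∑ i ∈ range (h + 1), q ^ i) ^ 2)

theorem derangementStep_apply (y q : R) (g : ℕ → R) (h : ℕ) :
    derangementStep y q g h = g (h + 1) + (1 + y * q) * (∑ i ∈ range h, q ^ i) * g h +
      y * (∑ i ∈ range h, q ^ i) ^ 2 * g (h - 1) := by
  cases h with
  | zero => simp [derangementStep, motzkinStep]
  | succ h => rfl

/-- The weighted sum over the placements on `s.offDiag`, where a placement with `h` free rows
(equivalently, `h` free columns) is weighted in addition by `g h`. -/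
noncomputable def placementSum (y q : R) (s : Finset α) (g : ℕ → R) : R :=
  ∑ p ∈ rookPlacements s.offDiag, placementWeight y q s p * g (#s - #p)

theorem placementSum_insert_max {s : Finset α} {a : α} (ha : ∀ j ∈ s, j < a) (y q : R)
    (g : ℕ → R) :
    placementSum y q (insert a s) g = placementSum y q s (derangementStep y q g) := by
  have has : a ∉ s := fun h => lt_irrefl a (ha a h)
  rw [placementSum, sum_rookPlacements_offDiag_insert has, placementSum]
  refine sum_congr rfl fun p hp => ?_
  obtain ⟨hps, hp⟩ := mem_rookPlacements.mp hp
  replace hps : p ⊆ s ×ˢ s := fun x hx =>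
    mem_product.mpr ⟨(mem_offDiag.mp (hps hx)).1, (mem_offDiag.mp (hps hx)).2.1⟩
  have h_rows : #(freeRows s p) = #s - #p :=
    card_freeRows (fun z hz => (mem_product.mp (hps hz)).1) hp
  have h_cols : #(freeCols s p) = #s - #p :=
    card_freeCols (fun z hz => (mem_product.mp (hps hz)).2) hp
  have h_card : #(insert a s) - #p = #s - #p + 1 := by
    rw [card_insert_of_notMem has, Nat.sub_add_comm (hp.card_le_of_subset_product hps)]
  have h_card_row (v : α) : #(insert a s) - #(insert (a, v) p) = #s - #p :=
    card_insert_sub_card_insert has fun h => has (mem_product.mp (hps h)).1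
  have h_card_col (i : α) : #(insert a s) - #(insert (i, a) p) = #s - #p :=
    card_insert_sub_card_insert has fun h => has (mem_product.mp (hps h)).2
  have h_card_row_col {v : α} (hv : v ∈ freeCols s p) (i : α) :
      #(insert a s) - #(insert (i, a) (insert (a, v) p)) = #s - #p - 1 := by
    have h_notMem : (i, a) ∉ insert (a, v) p := fun h => has <| by
      rcases mem_insert.mp h with h | h
      · exact (Prod.mk.inj h).2 ▸ (mem_freeCols.mp hv).1
      · exact (mem_product.mp (hps h)).2
    rw [card_insert_of_notMem h_notMem, ← Nat.sub_sub, h_card_row]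
  simp only [h_card, h_card_row, h_card_col, sum_add_distrib]
  rw [sum_congr rfl fun v hv => sum_congr rfl fun i _ => by rw [h_card_row_col hv i]]
  simp only [← sum_mul]
  rw [sum_placementWeight_insert_row_col ha hps, sum_placementWeight_insert_row ha hps,
    sum_placementWeight_insert_col ha hps, placementWeight_insert_line ha hps, h_rows, h_cols,
    derangementStep_apply]
  ring

theorem placementSum_eq_iterate (y q : R) (s : Finset α) (g : ℕ → R) :
    placementSum y q s g = (derangementStep y q)^[#s] g 0 := by
  induction s using Finset.induction_on_max generalizing g with
  | empty =>
    have h_empty : rookPlacements (∅ : Finset (α × α)) = {∅} := by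
      ext p
      simp +contextual [mem_rookPlacements, IsNonattacking, subset_empty]
    simp [placementSum, placementWeight, h_empty]
  | insert a s ha ih =>
    rw [placementSum_insert_max ha, ih, card_insert_of_notMem fun h => lt_irrefl a (ha a h),
      Function.iterate_succ_apply]

end PlacementWeights

section Derangements

open Finset

variable {α : Type*} [Fintype α]

/-- The graph of a permutation, as a set of cells of the square board on `α`. -/
def permGraph (σ : Equiv.Perm α) : Finset (α × α) :=
  univ.map ⟨fun i => (i, σ i), fun _ _ h => (Prod.mk.inj h).1⟩

theorem mem_permGraph {σ : Equiv.Perm α} {x : α × α} : x ∈ permGraph σ ↔ σ x.1 = x.2 := by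
  simp only [permGraph, mem_map, mem_univ, true_and]
  exact ⟨fun ⟨_, h⟩ => h ▸ rfl, fun h => ⟨x.1, Prod.ext rfl h⟩⟩

theorem forall_mem_permGraph {σ : Equiv.Perm α} {P : α × α → Prop} :
    (∀ x ∈ permGraph σ, P x) ↔ ∀ i, P (i, σ i) :=
  forall_mem_map.trans ⟨fun h i => h i (mem_univ i), fun h i _ => h i⟩

theorem card_permGraph (σ : Equiv.Perm α) : #(permGraph σ) = Fintype.card α := by
  rw [permGraph, card_map, card_univ]

theorem permGraph_injective : Function.Injective (permGraph : Equiv.Perm α → Finset (α × α)) :=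
  fun σ _ h => Equiv.ext fun i =>
    (mem_permGraph (x := (i, σ i)).mp (h ▸ mem_permGraph.mpr rfl)).symm

theorem isNonattacking_permGraph (σ : Equiv.Perm α) : IsNonattacking (permGraph σ) := by
  refine ⟨fun x hx z hz h => Prod.ext h ?_, fun x hx z hz h => Prod.ext ?_ h⟩
  · rw [← mem_permGraph.mp hx, ← mem_permGraph.mp hz, h]
  · exact σ.injective (by rw [mem_permGraph.mp hx, mem_permGraph.mp hz, h])

theorem exists_permGraph_eq {p : Finset (α × α)} (hp : IsNonattacking p)
    (hc : #p = Fintype.card α) : ∃ σ, permGraph σ = p := by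
  classical
  have h_surj (i : α) : ∃ x ∈ p, x.1 = i :=
    surj_on_of_inj_on_of_card_le (s := p) (t := univ) (fun x _ => x.1) (fun _ _ => mem_univ _)
      (fun x z hx hz h => hp.1 hx hz h) (by rw [hc, card_univ]) i (mem_univ i) |>.imp
        fun x ⟨hx, h⟩ => ⟨hx, h.symm⟩
  choose f hfp hf using h_surj
  have hinj : Function.Injective fun i => (f i).2 := fun i j h => by
    rw [← hf i, ← hf j, hp.2 (hfp i) (hfp j) h]
  refine ⟨Equiv.ofBijective _ (Finite.injective_iff_bijective.mp hinj), ?_⟩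
  refine eq_of_subset_of_card_le (fun x hx => ?_) (by rw [card_permGraph, hc])
  have hx : f x.1 = x := Prod.ext (hf x.1) (mem_permGraph.mp hx)
  exact hx ▸ hfp x.1

theorem permGraph_subset_offDiag_iff {σ : Equiv.Perm α} :
    permGraph σ ⊆ (univ : Finset α).offDiag ↔ σ ∈ derangements α := by
  simp only [subset_iff, forall_mem_permGraph, mem_offDiag, mem_univ, true_and]
  exact forall_congr' fun _ => ne_comm

theorem sum_rookPlacements_card_eq [DecidableEq α] {M : Type*} [AddCommMonoid M]
    (f : Finset (α × α) → M) :
    ∑ p ∈ rookPlacements (univ : Finset α).offDiag with #p = Fintype.card α, f p =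
      ∑ σ : derangements α, f (permGraph σ.1) := by
  symm
  refine sum_bij (fun σ _ => permGraph σ.1) (fun σ _ => ?_)
    (fun σ _ τ _ h => Subtype.ext (permGraph_injective h)) (fun p hp => ?_) fun _ _ => rfl
  · exact mem_filter.mpr ⟨mem_rookPlacements.mpr ⟨permGraph_subset_offDiag_iff.mpr σ.2,
      isNonattacking_permGraph σ.1⟩, card_permGraph σ.1⟩
  · obtain ⟨hp, hc⟩ := mem_filter.mp hp
    obtain ⟨hps, hp⟩ := mem_rookPlacements.mp hp
    obtain ⟨σ, rfl⟩ := exists_permGraph_eq hp hc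
    exact ⟨⟨σ, permGraph_subset_offDiag_iff.mp hps⟩, mem_univ _, rfl⟩

end Derangements

section DerangementWeights

open Finset

variable {α R : Type*} [Fintype α] [LinearOrder α] [CommSemiring R]

theorem rookCrossings_permGraph (σ : Equiv.Perm α) {i : α} (hi : σ i ≠ i) :
    rookCrossings univ (permGraph σ) (i, σ i) =
      #{j | (i < j ∧ j ≤ σ i ∧ σ i < σ j) ∨ (σ i < σ j ∧ σ j < i ∧ i < j)} := by
  simp only [rookCrossings, forall_mem_permGraph]
  rcases hi.lt_or_gt with h | h
  · rw [if_neg h.not_gt]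
    refine (card_equiv σ fun j => ?_).symm
    simp only [mem_filter, mem_univ, true_and, σ.injective.eq_iff, forall_eq]
    grind
  · rw [if_pos h]
    refine congrArg card (filter_congr fun j _ => ?_)
    simp only [forall_eq]
    grind

theorem card_filter_lt_permGraph {σ : Equiv.Perm α} (hσ : σ ∈ derangements α) :
    #{x ∈ permGraph σ | x.1 < x.2} = #{i | i ≤ σ i} := by
  rw [permGraph, filter_map, card_map]
  exact congrArg card (filter_congr fun i _ => ⟨le_of_lt, fun h => lt_of_le_of_ne h (hσ i).symm⟩)

theorem placementWeight_permGraph (y q : R) {n : ℕ} {σ : Equiv.Perm (Fin n)}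
    (hσ : σ ∈ derangements (Fin n)) :
    placementWeight y q univ (permGraph σ) = y ^ wex σ * q ^ cr σ := by
  have h_cr : ∑ x ∈ permGraph σ, rookCrossings univ (permGraph σ) x = cr σ := by
    refine (sum_map ..).trans ((sum_congr rfl fun i _ => rookCrossings_permGraph σ (hσ i)).trans ?_)
    simp only [cr, card_filter, ← univ_product_univ, sum_product]
  rw [placementWeight, h_cr, card_filter_lt_permGraph hσ, wex]

theorem placementSum_univ_single (y q : R) :
    placementSum y q (univ : Finset α) (Pi.single 0 1) =
      ∑ σ : derangements α, placementWeight y q univ (permGraph σ.1) := by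
  rw [placementSum, ← sum_rookPlacements_card_eq, sum_filter]
  refine sum_congr rfl fun p hp => ?_
  obtain ⟨-, hp⟩ := mem_rookPlacements.mp hp
  have h_le : #p ≤ #univ := hp.card_le_of_subset_product (t := univ) fun _ _ => by simp
  rw [Pi.single_apply, mul_ite, mul_one, mul_zero, ← card_univ]
  exact if_congr (by omega) rfl rfl

theorem sum_derangements_eq_iterate (y q : R) (n : ℕ) :
    ∑ σ : derangements (Fin n), y ^ wex σ.1 * q ^ cr σ.1 =
      (derangementStep y q)^[n] (Pi.single 0 1) 0 := by
  rw [sum_congr rfl fun σ _ => (placementWeight_permGraph y q σ.2).symm,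
    ← placementSum_univ_single, placementSum_eq_iterate, card_univ, Fintype.card_fin]

end DerangementWeights

theorem theorem2 {K : Type*} [Field K] (q : K) (hq : q ≠ 0) (n : ℕ) :
    ∑ σ : derangements (Fin n),
        (-(1 / q)) ^ wex (σ : Equiv.Perm (Fin n)) * q ^ cr (σ : Equiv.Perm (Fin n)) =
      if Even n then (-(1 / q)) ^ (n / 2) * qSecant q (n / 2) else 0 := by
  have h_level : 1 + -(1 / q) * q = 0 := by field_simp; ring
  have h_step : derangementStep (-(1 / q)) q =
      motzkinStep 0 fun h => -(1 / q) * qInt q (h + 1) ^ 2 := by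
    simp only [derangementStep, h_level, zero_mul, qInt]
    rfl
  rw [sum_derangements_eq_iterate, h_step, motzkinStep_zero_iterate_apply_zero, contFrac_const_mul,
    PowerSeries.coeff_rescale, qSecant]
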